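/- For a topological space $X$, let $\Delta(X)$ be the dispersion character of $X$, i.e. the smallest cardinality of a non-empty open subset of $X$; let $w(X)$ be the weight of $X$, i.e. the smallest cardinality of a base of $X$; and let $\mathrm{pd}(X)$ be the pinning down number of $X$, i.e. the smallest cardinal $\kappa$ such that for every neighborhood assignment $U$ on $X$ (a map assigning to each $x\in X$ an open set $U(x)$ with $x\in U(x)$) there is a set $A\subseteq X$ with $|A|\le\kappa$ and $A\cap U(x)\neq\emptyset$ for all $x\in X$. Theorem. Every regular topological space $X$ satisfies $$\min\{\Delta(X),\, w(X)\}\le 2^{\mathrm{pd}(X)}.$$ -/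

import Mathlib

universe u

namespace PinningDown

open Cardinal

/-- A neighborhood assignment on `X`: every point is assigned an open set containing it. -/
def IsNbhdAssignment {X : Type u} [TopologicalSpace X] (U : X → Set X) : Prop :=
  ∀ x, IsOpen (U x) ∧ x ∈ U x

/-- `A` pins down the assignment `U` if it meets every `U x`. -/
def PinsDown {X : Type u} (A : Set X) (U : X → Set X) : Prop :=
  ∀ x, (A ∩ U x).Nonempty

/-- The pinning down number: the least cardinal `κ` such that every neighborhood assignment
is pinned down by a set of size at most `κ`. (Supersets of a pinning set still pin down, so
"at most `κ`" and "exactly `κ`" give the same least cardinal.) -/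
noncomputable def pd (X : Type u) [TopologicalSpace X] : Cardinal.{u} :=
  sInf {κ : Cardinal.{u} | ∀ U : X → Set X, IsNbhdAssignment U →
    ∃ A : Set X, #A ≤ κ ∧ PinsDown A U}

/-- The dispersion character: the least cardinality of a non-empty open subset
(`0` for the empty space, which has no such subset). -/
noncomputable def dispersionCharacter (X : Type u) [TopologicalSpace X] : Cardinal.{u} :=
  sInf {κ : Cardinal.{u} | ∃ U : Set X, IsOpen U ∧ U.Nonempty ∧ #U = κ}

/-- The weight: the least cardinality of a base of the topology. -/
noncomputable def weight (X : Type u) [TopologicalSpace X] : Cardinal.{u} :=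
  sInf {κ : Cardinal.{u} | ∃ B : Set (Set X), TopologicalSpace.IsTopologicalBasis B ∧ #B = κ}

end PinningDown

/-!
A regular space has a base of regular open sets, so it suffices to bound the smaller of `Δ(X)` and
the number of regular open sets by `2 ^ pd X`, which is possible in every space. If `S` and `T` are
regular open and `S ⊈ T`, then `S \ closure T` is a nonempty open set.

For infinite `κ` equal to that minimum, take `κ` regular open sets. Their differences
`S \ closure T` are at most `κ ≤ Δ(X)` open sets of size at least `κ`, so they have distinct
representatives and hence all appear among the values of one neighborhood assignment. A set `A`
pinning it down meets all of them, so the traces on `A` of the `κ` regular open sets are distinct.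

This fails for finite `κ`, since there are more differences than sets. If `pd X` is infinite there
is nothing to prove. If `pd X = n` is finite, a disjoint family of nonempty open sets has at most
`n` members; for a largest such family, every nonempty open `V` has some member inside
`closure V`, which makes a regular open set determined by the members it meets.
-/

namespace PinningDown

open Cardinal Set Function

universe v

section DistinctRepresentatives

theorem exists_injective_mem_of_not_subset_range {ι α : Type*} [LinearOrder ι] [WellFoundedLT ι]
    (f : ι → Set α) (hf : ∀ i, ∀ g : Iio i → α, ¬f i ⊆ range g) :
    ∃ g : ι → α, Injective g ∧ ∀ i, g i ∈ f i := by
  choose F F_mem F_notMem using fun i g => not_subset.1 (hf i g)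
  let g : ι → α := WellFoundedLT.fix fun i g => F i fun j => g j.1 j.2
  have g_eq (i : ι) : g i = F i fun j => g j := WellFoundedLT.fix_eq _ i
  have g_ne {i j : ι} (hji : j < i) : g j ≠ g i := fun h =>
    F_notMem i (fun j => g j) ⟨⟨j, hji⟩, h.trans (g_eq i)⟩
  exact ⟨g, Injective.of_lt_imp_ne fun _ _ => g_ne, fun i => g_eq i ▸ F_mem i _⟩

theorem exists_injective_mem_of_mk_le {ι α : Type u} (f : ι → Set α) (hf : ∀ i, #ι ≤ #(f i)) :
    ∃ g : ι → α, Injective g ∧ ∀ i, g i ∈ f i := by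
  obtain ⟨_, _, hι⟩ := exists_ord_eq_type_lt ι
  refine exists_injective_mem_of_not_subset_range f fun i g hg => ?_
  exact ((hf i).trans ((mk_le_mk_of_subset hg).trans mk_range_le)).not_gt (mk_Iio_lt i hι)

theorem injective_of_mem_of_pairwise_disjoint {ι α : Type*} {W : ι → Set α} {g : ι → α}
    (hW : Pairwise (Disjoint on W)) (hg : ∀ i, g i ∈ W i) : Injective g := fun i j hij =>
  hW.eq (not_disjoint_iff.2 ⟨g i, hg i, hij ▸ hg j⟩)

end DistinctRepresentatives

section RegularOpen

variable {X : Type*} [TopologicalSpace X] {S T : Set X}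

/-- `S` is a regular open set. Regular open sets form a base of a regular space, and distinct ones
have a symmetric difference with nonempty interior. Openness follows from the equation. -/
def IsRegularOpen (S : Set X) : Prop :=
  interior (closure S) = S

theorem IsRegularOpen.isOpen (hS : IsRegularOpen S) : IsOpen S :=
  interior_eq_iff_isOpen.1 (hS ▸ interior_interior)

theorem IsRegularOpen.isOpen_sdiff_closure (hS : IsRegularOpen S) (T : Set X) :
    IsOpen (S \ closure T) :=
  hS.isOpen.sdiff isClosed_closure

theorem IsRegularOpen.subset_of_sdiff_closure_eq_empty (hT : IsRegularOpen T) (hS : IsOpen S)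
    (h : S \ closure T = ∅) : S ⊆ T :=
  hT ▸ interior_maximal (sdiff_eq_empty.1 h) hS

theorem isRegularOpen_interior {C : Set X} (hC : IsClosed C) : IsRegularOpen (interior C) :=
  (interior_mono (closure_minimal interior_subset hC)).antisymm
    (interior_maximal subset_closure isOpen_interior)

theorem isTopologicalBasis_isRegularOpen [RegularSpace X] :
    TopologicalSpace.IsTopologicalBasis {S : Set X | IsRegularOpen S} := by
  refine TopologicalSpace.isTopologicalBasis_of_isOpen_of_nhds (fun S hS => hS.isOpen) ?_
  intro x U hx hU
  obtain ⟨C, hCx, hC, hCU⟩ := exists_mem_nhds_isClosed_subset (hU.mem_nhds hx)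
  exact ⟨interior C, isRegularOpen_interior hC, mem_interior_iff_mem_nhds.2 hCx,
    interior_subset.trans hCU⟩

end RegularOpen

section Counting

variable {X : Type u} [TopologicalSpace X] {ι : Type v} {R : Set (Set X)} {W : ι → Set X}

theorem injOn_setOf_inter_nonempty (hR : ∀ S ∈ R, IsRegularOpen S)
    (hW : ∀ S ∈ R, ∀ T ∈ R, (S \ closure T).Nonempty →
      ∃ i, (W i ∩ S).Nonempty ∧ Disjoint (W i) T) :
    InjOn (fun S => {i | (W i ∩ S).Nonempty}) R := by
  have subset_of_trace_eq : ∀ S ∈ R, ∀ T ∈ R,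
      {i | (W i ∩ S).Nonempty} = {i | (W i ∩ T).Nonempty} → S ⊆ T := by
    intro S hS T hT hST
    refine (hR T hT).subset_of_sdiff_closure_eq_empty (hR S hS).isOpen ?_
    by_contra hne
    obtain ⟨i, hiS, hiT⟩ := hW S hS T hT (nonempty_iff_ne_empty.2 hne)
    exact not_disjoint_iff_nonempty_inter.2 (hST.subset hiS) hiT
  exact fun S hS T hT hST =>
    (subset_of_trace_eq S hS T hT hST).antisymm (subset_of_trace_eq T hT S hS hST.symm)

theorem lift_mk_le_two_pow_of_separating (hR : ∀ S ∈ R, IsRegularOpen S)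
    (hW : ∀ S ∈ R, ∀ T ∈ R, (S \ closure T).Nonempty →
      ∃ i, (W i ∩ S).Nonempty ∧ Disjoint (W i) T) :
    lift.{v} #R ≤ 2 ^ lift.{u} #ι := by
  simpa using lift_mk_le_lift_mk_of_injective (injOn_setOf_inter_nonempty hR hW).injective

theorem mk_le_two_pow_of_inter_nonempty {A : Set X} (hR : ∀ S ∈ R, IsRegularOpen S)
    (hA : ∀ S ∈ R, ∀ T ∈ R, (S \ closure T).Nonempty → (A ∩ (S \ closure T)).Nonempty) :
    #R ≤ 2 ^ #A := by
  have hsep : ∀ S ∈ R, ∀ T ∈ R, (S \ closure T).Nonempty →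
      ∃ a : A, ({a.1} ∩ S).Nonempty ∧ Disjoint {a.1} T := by
    intro S hS T hT hne
    obtain ⟨a, haA, haS, haT⟩ := hA S hS T hT hne
    exact ⟨⟨a, haA⟩, singleton_inter_nonempty.2 haS,
      disjoint_singleton_left.2 fun h => haT (subset_closure h)⟩
  simpa using lift_mk_le_two_pow_of_separating hR hsep

theorem lift_mk_regularOpen_le_two_pow (hWo : ∀ i, IsOpen (W i))
    (hWne : ∀ i, (W i).Nonempty)
    (hW : ∀ V : Set X, IsOpen V → V.Nonempty → ∃ i, W i ⊆ closure V) :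
    lift.{v} #{S : Set X | IsRegularOpen S} ≤ 2 ^ lift.{u} #ι := by
  refine lift_mk_le_two_pow_of_separating (W := W) (fun S hS => hS) fun S hS T hT hne => ?_
  obtain ⟨i, hi⟩ := hW _ (hS.isOpen_sdiff_closure T) hne
  obtain ⟨x, hx⟩ := hWne i
  obtain ⟨y, hyW, hyS, -⟩ := mem_closure_iff.1 (hi hx) _ (hWo i) hx
  have hdisj : Disjoint (S \ closure T) T := disjoint_sdiff_left.mono_right subset_closure
  exact ⟨i, ⟨y, hyW, hyS⟩, (hdisj.closure_left hT.isOpen).mono_left hi⟩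

end Counting

section Cellular

variable {X : Type u} [TopologicalSpace X] {ι : Type v}

/-- A cellular family: pairwise disjoint nonempty open sets. It is indexed rather than a set of
sets, so that its cardinality is that of the index type. -/
structure IsCellular (W : ι → Set X) : Prop where
  isOpen : ∀ i, IsOpen (W i)
  nonempty : ∀ i, (W i).Nonempty
  disjoint : Pairwise (Disjoint on W)

theorem IsCellular.cons_sdiff_closure {n : ℕ} {W : Fin n → Set X} {V : Set X} (hW : IsCellular W)
    (hV : IsOpen V) (hne : V.Nonempty) (hWV : ∀ i, ¬W i ⊆ closure V) :
    IsCellular (Fin.cons V fun i => W i \ closure V : Fin (n + 1) → Set X) where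
  isOpen := Fin.cases hV fun i => (hW.isOpen i).sdiff isClosed_closure
  nonempty := Fin.cases hne fun i => sdiff_nonempty.2 (hWV i)
  disjoint := by
    have hVW (i : Fin n) : Disjoint V (W i \ closure V) :=
      disjoint_sdiff_right.mono_left subset_closure
    refine pairwise_fin_succ_iff.2 ⟨fun i => (hVW i).symm, hVW, fun i j hij => ?_⟩
    exact (hW.disjoint hij).mono sdiff_subset sdiff_subset

theorem IsCellular.exists_fin_succ {n : ℕ} {W : Fin n → Set X} (hW : IsCellular W)
    (hn : (2 : Cardinal) ^ n < #{S : Set X | IsRegularOpen S}) :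
    ∃ W' : Fin (n + 1) → Set X, IsCellular W' := by
  by_contra hmax
  have hdense : ∀ V : Set X, IsOpen V → V.Nonempty → ∃ i, W i ⊆ closure V := by
    intro V hV hne
    by_contra! hWV
    exact hmax ⟨_, hW.cons_sdiff_closure hV hne hWV⟩
  have hle := lift_mk_regularOpen_le_two_pow hW.isOpen hW.nonempty hdense
  simp only [lift_uzero, mk_fin, lift_natCast, power_natCast] at hle
  exact hle.not_gt hn

theorem exists_isCellular_fin_succ {n : ℕ}
    (hn : (2 : Cardinal) ^ n < #{S : Set X | IsRegularOpen S}) :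
    ∃ W : Fin (n + 1) → Set X, IsCellular W := by
  induction n with
  | zero => exact IsCellular.exists_fin_succ (W := Fin.elim0) ⟨nofun, nofun, nofun⟩ hn
  | succ n ih =>
    obtain ⟨W, hW⟩ := ih ((pow_le_pow_right₀ one_le_two n.le_succ).trans_lt hn)
    exact hW.exists_fin_succ hn

end Cellular

section PinningDownNumber

variable {X : Type u} [TopologicalSpace X]

theorem IsNbhdAssignment.exists_pinsDown_mk_le_pd {U : X → Set X} (hU : IsNbhdAssignment U) :
    ∃ A : Set X, #A ≤ pd X ∧ PinsDown A U := by
  refine csInf_mem (s := {κ | ∀ U : X → Set X, IsNbhdAssignment U →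
    ∃ A : Set X, #A ≤ κ ∧ PinsDown A U}) ?_ U hU
  exact ⟨#X, fun U hU => ⟨univ, mk_univ.le, fun x => ⟨x, mem_univ x, (hU x).2⟩⟩⟩

theorem exists_mk_le_pd_forall_inter_nonempty {ι : Type*} {g : ι → X} {f : ι → Set X}
    (hg : Injective g) (hf : ∀ i, IsOpen (f i)) (hgf : ∀ i, g i ∈ f i) :
    ∃ A : Set X, #A ≤ pd X ∧ ∀ i, (A ∩ f i).Nonempty := by
  have hU : IsNbhdAssignment (extend g f fun _ => univ) := by
    intro x
    by_cases hx : ∃ i, g i = x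
    · obtain ⟨i, rfl⟩ := hx
      rw [hg.extend_apply]
      exact ⟨hf i, hgf i⟩
    · rw [extend_apply' _ _ _ hx]
      exact ⟨isOpen_univ, mem_univ x⟩
  obtain ⟨A, hA, hAU⟩ := hU.exists_pinsDown_mk_le_pd
  exact ⟨A, hA, fun i => hg.extend_apply f _ i ▸ hAU (g i)⟩

theorem IsCellular.lift_mk_le_pd {ι : Type v} {W : ι → Set X} (hW : IsCellular W) :
    lift.{u} #ι ≤ lift.{v} (pd X) := by
  choose g hg using hW.nonempty
  obtain ⟨A, hA, hAW⟩ := exists_mk_le_pd_forall_inter_nonempty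
    (injective_of_mem_of_pairwise_disjoint hW.disjoint hg) hW.isOpen hg
  choose a haA haW using hAW
  have ha : Injective a := injective_of_mem_of_pairwise_disjoint hW.disjoint haW
  exact (lift_mk_le_lift_mk_of_injective (ha.codRestrict haA)).trans (lift_le.2 hA)

theorem dispersionCharacter_le_mk {V : Set X} (hV : IsOpen V) (hne : V.Nonempty) :
    dispersionCharacter X ≤ #V :=
  csInf_le' ⟨V, hV, hne, rfl⟩

theorem exists_mk_le_pd_of_mk_le_dispersionCharacter {ι : Type u} {f : ι → Set X}
    (hι : #ι ≤ dispersionCharacter X) (hf : ∀ i, IsOpen (f i)) (hne : ∀ i, (f i).Nonempty) :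
    ∃ A : Set X, #A ≤ pd X ∧ ∀ i, (A ∩ f i).Nonempty := by
  obtain ⟨g, hg, hgf⟩ :=
    exists_injective_mem_of_mk_le f fun i => hι.trans (dispersionCharacter_le_mk (hf i) (hne i))
  exact exists_mk_le_pd_forall_inter_nonempty hg hf hgf

theorem mk_regularOpen_le_of_pd_lt_aleph0 (h : pd X < ℵ₀) :
    #{S : Set X | IsRegularOpen S} ≤ 2 ^ pd X := by
  obtain ⟨n, hn⟩ := lt_aleph0.1 h
  by_contra! hlt
  rw [hn, power_natCast] at hlt
  obtain ⟨W, hW⟩ := exists_isCellular_fin_succ hlt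
  have hle : ((n + 1 : ℕ) : Cardinal.{u}) ≤ n := by simpa [hn] using hW.lift_mk_le_pd
  exact (Nat.cast_le.1 hle).not_gt n.lt_succ_self

theorem mk_le_two_pow_pd_of_le_dispersionCharacter {R : Set (Set X)}
    (hR : ∀ S ∈ R, IsRegularOpen S) (hinf : ℵ₀ ≤ #R) (hle : #R ≤ dispersionCharacter X) :
    #R ≤ 2 ^ pd X := by
  let ι := {p : R × R // (p.1.1 \ closure p.2.1).Nonempty}
  have hι : #ι ≤ dispersionCharacter X :=
    calc #ι ≤ #(R × R) := mk_subtype_le _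
      _ = #R := by rw [mk_prod, lift_id, mul_eq_self hinf]
      _ ≤ dispersionCharacter X := hle
  obtain ⟨A, hA, hAR⟩ := exists_mk_le_pd_of_mk_le_dispersionCharacter hι
    (fun p => (hR _ p.1.1.2).isOpen_sdiff_closure p.1.2.1) fun p => p.2
  calc #R ≤ 2 ^ #A := mk_le_two_pow_of_inter_nonempty hR fun S hS T hT hne =>
        hAR ⟨(⟨S, hS⟩, ⟨T, hT⟩), hne⟩
    _ ≤ 2 ^ pd X := power_le_power_left two_ne_zero hA

theorem weight_le_mk_regularOpen [RegularSpace X] : weight X ≤ #{S : Set X | IsRegularOpen S} :=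
  csInf_le' ⟨_, isTopologicalBasis_isRegularOpen, rfl⟩

end PinningDownNumber

end PinningDown

open PinningDown Cardinal in
theorem mainTheorem4_general (X : Type u) [TopologicalSpace X] :
    min (dispersionCharacter X) #{S : Set X | IsRegularOpen S} ≤ 2 ^ pd X := by
  obtain hpd | hpd := lt_or_ge (pd X) ℵ₀
  · exact (min_le_right _ _).trans (mk_regularOpen_le_of_pd_lt_aleph0 hpd)
  obtain ⟨R, hR, hRcard⟩ := le_mk_iff_exists_subset.1
    (min_le_right (dispersionCharacter X) #{S : Set X | IsRegularOpen S})
  rw [← hRcard]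
  obtain hfin | hinf := lt_or_ge #R ℵ₀
  · exact (hfin.le.trans hpd).trans (cantor _).le
  · exact mk_le_two_pow_pd_of_le_dispersionCharacter hR hinf (hRcard.trans_le (min_le_left _ _))

theorem mainTheorem4 (X : Type u) [TopologicalSpace X] [RegularSpace X] :
    min (PinningDown.dispersionCharacter X) (PinningDown.weight X)
      ≤ (2 : Cardinal.{u}) ^ PinningDown.pd X :=
  (min_le_min_left _ PinningDown.weight_le_mk_regularOpen).trans (mainTheorem4_general X)
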